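/- **Definitions.** Let $\mathbf 1=\{0\}$. A *diagram* consists of a family $\mathscr S=(S_i)_{i\in I}$ of sets, a subfamily $\mathscr S'\subset\mathscr S$, and a family $\mathscr M$ of maps $\varphi:2^{S}\to 2^{T}$ with $S=\mathrm{dm}(\varphi)$, $T=\mathrm{cdm}(\varphi)$ in $\mathscr S$. A *cross section* of it assigns to each $S\in\mathscr S$ a subset $s(S)\subset S$ such that, for every $S$ that is the codomain of at least one $\varphi\in\mathscr M$, $s(S)=\bigcap_{\mathrm{cdm}(\varphi)=S}\varphi(s(\mathrm{dm}(\varphi)))$ if $S\notin\mathscr S'$ and $s(S)=\bigcup_{\mathrm{cdm}(\varphi)=S}\varphi(s(\mathrm{dm}(\varphi)))$ if $S\in\mathscr S'$. Let $\mathscr M_{\mathrm S}$ be a set of maps. The maps *generated by* $\mathscr M_{\mathrm S}$ are those obtained from the maps in $\mathscr M_{\mathrm S}$, identity maps, the maps $\omega:X\to\mathbf 1$ and the projections of finite Cartesian products, by composition and by forming products $f_1\times\cdots\times f_n:X\to Y_1\times\cdots\times Y_n$, $x\mapsto(f_1(x),\dots,f_n(x))$, of maps $f_i:X\to Y_i$.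 The *size* of a generated map is the least cost of such a construction, where each basic map costs $1$ and each composition or product costs $1$ plus the sum of the costs of its components. A diagram is *generated by* $\mathscr M_{\mathrm S}$ if each of its maps is the image map $A\mapsto f(A)$ or the preimage map $A\mapsto f^{-1}(A)$ of a generated map $f$; the size of such a map is the (least possible) size of $f$, and the size of the diagram is the sum of the sizes of its maps. For a set $X$ and $A\subset X$, the *structural information* $I(A\mid\mathscr M_{\mathrm S})\in\mathbb N\cup\{\infty\}$ is the minimal size of a diagram generated by $\mathscr M_{\mathrm S}$, with a member of $\mathscr S$ equal to $\mathbf 1$ and a member equal to $X$, such that cross sections $s$ of the diagram with $s(\mathbf 1)=\mathbf 1$ exist and all of them satisfy $s(X)=A$ (and $\infty$ if there is no such diagram of finite size). Let $\mathscr M_{\mathbb N}=\{0,\mathrm{succ}\}$ with $0:\mathbf 1\to\mathbb N$ the constant map and $\mathrm{succ}:\mathbb N\to\mathbb N$ the successor function. For a binary string $\sigma=\sigma[0]\cdots\sigma[|\sigma|-1]$ put $$\bar\sigma=\{(i,\sigma[i])\mid 0\le i<|\sigma|\}\cup\{(|\sigma|,0),(|\sigma|,1)\}\subset\mathbb N\times\mathbb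 N .$$ A Turing machine $M$ is deterministic, with a finite set $Q_M$ of states (among them an initial, an accept and a reject state), a finite set $\Theta_M$ of internal symbols containing $0$, $1$ and a blank different from them, and a transition function $\Theta_M\times Q_M\to\Theta_M\times Q_M\times\{\text{left},\text{right}\}$. It has one one-sided infinite tape, starts at the leftmost cell with its input followed by blanks on the tape, stays at the leftmost cell when told to move left there, and stops in the accept and reject states. We write $M(p)=\sigma$ if $M$ on input $p\in\{0,1\}^*$ reaches the accept state with exactly $\sigma$ followed by blanks on its tape. **Statement.** There is a constant $c\in\mathbb N$ such that for every binary string $\sigma$ $$I(\bar\sigma\mid\mathscr M_{\mathbb N})\;\le\; c\cdot\min_{\substack{M\text{ Turing machine},\ p\in\{0,1\}^*\\ M(p)=\sigma}}\bigl(|p|+|\Theta_M|\,|Q_M|\bigr),$$ where the minimum is over a nonempty set. -/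

import Mathlib

namespace StructInfo

/-! ### Diagrams and cross sections -/

/-- A diagram: a family `carrier` of sets indexed by `Idx`, a subfamily `unionIdx` of it, and a
family of maps between power sets.  The index set of the family of maps is the disjoint union over
all `a b : Idx` of the types `Edge a b`; the elements of `Edge a b` index the maps with domain the
power set of `carrier a` and codomain the power set of `carrier b`. -/
structure Diagram where
  Idx : Type
  carrier : Idx → Type
  unionIdx : Set Idx
  Edge : Idx → Idx → Type
  map : ∀ {a b : Idx}, Edge a b → Set (carrier a) → Set (carrier b)

namespace Diagram

variable (D : Diagram)

/-- The incoming maps at the member `b` of the family. -/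
def In (b : D.Idx) : Type := Σ a : D.Idx, D.Edge a b

/-- All maps of the diagram. -/
def Maps : Type := Σ b : D.Idx, D.In b

/-- `s` is a cross section of the diagram: at every member with at least one incoming map it is
the intersection (for members of the distinguished subfamily: the union) of the images by the
incoming maps. -/
def IsCrossSection (s : ∀ i : D.Idx, Set (D.carrier i)) : Prop :=
  ∀ b : D.Idx, Nonempty (D.In b) →
    (b ∉ D.unionIdx → s b = ⋂ e : D.In b, D.map e.2 (s e.1)) ∧
    (b ∈ D.unionIdx → s b = ⋃ e : D.In b, D.map e.2 (s e.1))

/-- The cross sections of the diagram that restrict to the cross section `t` of the subfamily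
`T`. -/
def sectionsExtending (T : Set D.Idx) (t : ∀ i : T, Set (D.carrier i)) :
    Set (∀ i : D.Idx, Set (D.carrier i)) :=
  {s | D.IsCrossSection s ∧ ∀ i : T, s i = t i}

/-- The diagram together with the partial cross section `t` on `T` represents the subset `A` of
the member `x`: there is a cross section that extends `t`, and every such cross section takes the
value `A` at `x`.  Without the first condition a contradictory diagram would represent
everything. -/
def Represents (T : Set D.Idx) (t : ∀ i : T, Set (D.carrier i)) (x : D.Idx)
    (A : Set (D.carrier x)) : Prop :=
  (D.sectionsExtending T t).Nonempty ∧ ∀ s ∈ D.sectionsExtending T t, s x = A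

end Diagram

/-! ### Maps generated by a set of maps, and their sizes -/

/-- `GeneratedWithSize M f n`: the map `f` is obtained from `M`, identities, the maps
`ω : X → {0}` and projections (each counted with size `1`) by compositions and products, where the
size of a composition or product is `1` plus the sum of the sizes of its components; `n` is the
resulting size.  The Cartesian product of `X 0, …, X (n-1)` is `∀ i : Fin n, X i`, and the
one-point set `{0}` is `Fin 1`. -/
inductive GeneratedWithSize (M : Set (Σ X Y : Type, X → Y)) :
    ∀ {X Y : Type}, (X → Y) → ℕ → Prop
  | base {X Y : Type} (f : X → Y) (hf : ⟨X, Y, f⟩ ∈ M) : GeneratedWithSize M f 1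
  | ident (X : Type) : GeneratedWithSize M (fun x : X => x) 1
  | omega (X : Type) : GeneratedWithSize M (fun _ : X => (0 : Fin 1)) 1
  | proj {n : ℕ} (X : Fin n → Type) (i : Fin n) :
      GeneratedWithSize M (fun x : (∀ j : Fin n, X j) => x i) 1
  | comp {X Y Z : Type} {f : X → Y} {g : Y → Z} {a b : ℕ}
      (hf : GeneratedWithSize M f a) (hg : GeneratedWithSize M g b) :
      GeneratedWithSize M (fun x => g (f x)) (1 + (b + a))
  | prod {n : ℕ} (hn : 0 < n) {X : Type} {Y : Fin n → Type} {f : ∀ i : Fin n, X → Y i}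
      {a : Fin n → ℕ} (hf : ∀ i : Fin n, GeneratedWithSize M (f i) (a i)) :
      GeneratedWithSize M (fun (x : X) (i : Fin n) => f i x) (1 + ∑ i : Fin n, a i)

/-- `f` belongs to the set of maps generated by `M`. -/
def Generated (M : Set (Σ X Y : Type, X → Y)) {X Y : Type} (f : X → Y) : Prop :=
  ∃ n : ℕ, GeneratedWithSize M f n

/-- The size of `f` relative to `M`: the least size of a way to generate `f` from `M`. -/
noncomputable def mapSize (M : Set (Σ X Y : Type, X → Y)) {X Y : Type} (f : X → Y) : ℕ∞ :=
  ⨅ (n : ℕ) (_ : GeneratedWithSize M f n), (n : ℕ∞)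

/-- The diagram is generated by `M`: each of its maps is the power map or the inverse map of a map
generated by `M`. -/
def Diagram.GeneratedBy (D : Diagram) (M : Set (Σ X Y : Type, X → Y)) : Prop :=
  ∀ (a b : D.Idx) (e : D.Edge a b),
    (∃ f : D.carrier a → D.carrier b, Generated M f ∧ D.map e = fun A => f '' A) ∨
    (∃ f : D.carrier b → D.carrier a, Generated M f ∧ D.map e = fun A => f ⁻¹' A)

/-- The size, relative to `M`, of a map `φ` between power sets that is the power map or the inverse
map of a map generated by `M`. -/
noncomputable def powerMapSize (M : Set (Σ X Y : Type, X → Y)) {X Y : Type}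
    (φ : Set X → Set Y) : ℕ∞ :=
  min (⨅ (f : X → Y) (_ : φ = fun A => f '' A), mapSize M f)
    (⨅ (f : Y → X) (_ : φ = fun A => f ⁻¹' A), mapSize M f)

/-- The total size of the maps of the diagram. -/
noncomputable def Diagram.size (D : Diagram) (M : Set (Σ X Y : Type, X → Y)) : ℕ∞ :=
  ∑' e : D.Maps, powerMapSize M (D.map e.2.2)

/-- The structural information `I(A | M)` of the subset `A` of `X` relative to `M`: the minimum of
the total size over all diagrams generated by `M` that represent `A` at a member equal to `X`, with
the partial cross section whose subfamily consists of one member equal to `{0}` and whose value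
there is all of `{0}`; it is `∞` if there is no such diagram of finite size. -/
noncomputable def structuralInfo (M : Set (Σ X Y : Type, X → Y)) {X : Type} (A : Set X) : ℕ∞ :=
  sInf {n : ℕ∞ | ∃ (D : Diagram) (one x : D.Idx) (_ : D.carrier one = Fin 1)
    (hx : D.carrier x = X),
    D.GeneratedBy M ∧
    D.Represents {one} (fun _ => Set.univ) x (cast hx ⁻¹' A) ∧
    n = D.size M}

/-- The structure maps of the natural numbers: the constant map `0 : {0} → ℕ` and the successor
function. -/
def natMaps : Set (Σ X Y : Type, X → Y) :=
  {⟨Fin 1, ℕ, fun _ => 0⟩, ⟨ℕ, ℕ, Nat.succ⟩}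

/-- The subset of `ℕ × ℕ` that represents the binary string `σ`: the pairs `(i, σ[i])` for
`i < |σ|`, and the two pairs `(|σ|, 0)` and `(|σ|, 1)`. -/
def stringSet (σ : List (Fin 2)) : Set (Fin 2 → ℕ) :=
  {x | ∃ i : Fin σ.length, x = ![(i : ℕ), (σ.get i : ℕ)]} ∪ {![σ.length, 0], ![σ.length, 1]}

/-! ### Turing machines -/

/-- A deterministic one-tape Turing machine with binary input alphabet: finite set `Q` of states,
finite set `Θ` of internal symbols that contains the two bits and a blank different from them,
transition function `δ` (the last component gives the direction: `0` is left and `1` is right),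
initial, accept and reject states. -/
structure TuringMachine where
  Q : Type
  Θ : Type
  [finQ : Fintype Q]
  [finΘ : Fintype Θ]
  bit : Fin 2 ↪ Θ
  blank : Θ
  bit_ne_blank : ∀ b, bit b ≠ blank
  δ : Θ × Q → Θ × Q × Fin 2
  q₀ : Q
  qA : Q
  qR : Q

namespace TuringMachine

variable (M : TuringMachine)

/-- A configuration: the state, the head position and the content of the one-sided tape. -/
structure Config where
  state : M.Q
  head : ℕ
  tape : ℕ → M.Θ

/-- The tape that contains the binary string `σ` followed by blanks. -/
def tapeOf (σ : List (Fin 2)) (i : ℕ) : M.Θ :=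
  if h : i < σ.length then M.bit (σ.get ⟨i, h⟩) else M.blank

/-- The initial configuration on the input `p`. -/
def initial (p : List (Fin 2)) : M.Config := ⟨M.q₀, 0, M.tapeOf p⟩

open Classical in
/-- One step.  The machine stops in the accept and reject states; a head at position `0` that is
told to move left stays there. -/
noncomputable def step (c : M.Config) : M.Config :=
  if c.state = M.qA ∨ c.state = M.qR then c
  else
    let r := M.δ (c.tape c.head, c.state)
    { state := r.2.1
      head := if r.2.2 = 0 then c.head - 1 else c.head + 1
      tape := Function.update c.tape c.head r.1 }

/-- `M(p) = σ`: the machine accepts the input `p` and leaves the string `σ` on its tape. -/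
def Outputs (p σ : List (Fin 2)) : Prop :=
  ∃ k : ℕ, (M.step^[k] (M.initial p)).state = M.qA ∧
    (M.step^[k] (M.initial p)).tape = M.tapeOf σ

/-- The number `|Θ_M|` of internal symbols. -/
def numSymbols : ℕ := @Fintype.card M.Θ M.finΘ

/-- The number `|Q_M|` of states. -/
def numStates : ℕ := @Fintype.card M.Q M.finQ

end TuringMachine

end StructInfo

/-! A run of `M` on `p` is a family of relations between times and positions: where each symbol
lies, and where the head is in each state. The relations at time `t + 1` arise from those at time
`t` by images, preimages, unions and intersections along maps of bounded size built from `0` and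
`succ`. The input costs a bounded number of maps per letter, the transition function a bounded
number per pair of a symbol and a state, and everything else is bounded or absorbed, so the total is
`O(|p| + |Θ_M| |Q_M|)`.

Two operations are missing and have to be simulated. There is no complement: "the head is elsewhere"
comes from the relation of inequality, which is itself generated by recursion. There is no
predecessor: moves to the left use preimages under the successor.

Existence: the actual run is a cross section (`AcceptsAt.isCrossSection`). Uniqueness: recursive
equations may have several solutions, but here every map lowers a well-founded rank
(`Node.Edge.arrow_lowers`), so membership of each element is forced by induction
(`Diagram.IsCrossSection.eq_of_rank`), at unions and intersections alike.

Transitions act only in live states, so the relations stop at the time `T` of acceptance. The accept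
state marks `T`, which selects the final tape; the end of the output is the only blank cell whose
position is `0` or the successor of that of a cell with a bit. -/

namespace StructInfo

/-! ### Power maps and inverse maps -/

/-- A map between power sets that is the image map or the preimage map of a map. -/
inductive Arrow (X Y : Type) : Type
  | image (f : X → Y) : Arrow X Y
  | preimage (f : Y → X) : Arrow X Y

namespace Arrow

variable {X Y : Type}

/-- The map between power sets. -/
def apply : Arrow X Y → Set X → Set Y
  | image f => fun A => f '' A
  | preimage f => fun A => f ⁻¹' A

/-- The underlying map is generated by `M` with size at most `K`. -/
def GeneratedWithin (M : Set (Σ X Y : Type, X → Y)) (K : ℕ) : Arrow X Y → Prop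
  | image f => ∃ n ≤ K, GeneratedWithSize M f n
  | preimage f => ∃ n ≤ K, GeneratedWithSize M f n

/-- Membership of `y` in a value of the arrow depends only on elements of smaller rank. -/
def Lowers {W : Type} [LT W] (r : X → W) (r' : Y → W) : Arrow X Y → Prop
  | image f => ∀ x, r x < r' (f x)
  | preimage f => ∀ y, r (f y) < r' y

theorem mem_apply_congr {W : Type} [LT W] {r : X → W} {r' : Y → W} {φ : Arrow X Y}
    (h : φ.Lowers r r') {A B : Set X} {y : Y} (hAB : ∀ x, r x < r' y → (x ∈ A ↔ x ∈ B)) :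
    y ∈ φ.apply A ↔ y ∈ φ.apply B := by
  cases φ with
  | image f =>
    constructor
    · rintro ⟨x, hx, rfl⟩
      exact ⟨x, (hAB x (h x)).1 hx, rfl⟩
    · rintro ⟨x, hx, rfl⟩
      exact ⟨x, (hAB x (h x)).2 hx, rfl⟩
  | preimage f => exact hAB _ (h y)

theorem mapSize_le {M : Set (Σ X Y : Type, X → Y)} {f : X → Y} {n K : ℕ} (hn : n ≤ K)
    (h : GeneratedWithSize M f n) : mapSize M f ≤ K :=
  (iInf₂_le n h).trans (by exact_mod_cast hn)

theorem powerMapSize_le {M : Set (Σ X Y : Type, X → Y)} {K : ℕ} {φ : Arrow X Y}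
    (h : φ.GeneratedWithin M K) : powerMapSize M φ.apply ≤ K := by
  cases φ with
  | image f =>
    obtain ⟨n, hn, h⟩ := h
    refine (min_le_left _ _).trans (iInf_le_of_le f ?_)
    exact iInf_le_of_le rfl (mapSize_le hn h)
  | preimage f =>
    obtain ⟨n, hn, h⟩ := h
    refine (min_le_right _ _).trans (iInf_le_of_le f ?_)
    exact iInf_le_of_le rfl (mapSize_le hn h)

theorem generated {M : Set (Σ X Y : Type, X → Y)} {K : ℕ} {φ : Arrow X Y}
    (h : φ.GeneratedWithin M K) :
    (∃ f : X → Y, Generated M f ∧ φ.apply = fun A => f '' A) ∨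
      (∃ f : Y → X, Generated M f ∧ φ.apply = fun A => f ⁻¹' A) := by
  cases φ with
  | image f => exact Or.inl ⟨f, h.imp fun _ h => h.2, rfl⟩
  | preimage f => exact Or.inr ⟨f, h.imp fun _ h => h.2, rfl⟩

end Arrow

/-! ### Uniqueness of cross sections, and bounds for the size of a diagram. -/

namespace Diagram

variable {D : Diagram}

/-- Two cross sections agree if they agree at the members without incoming maps and every map is
given by an arrow that lowers a well-founded rank. -/
theorem IsCrossSection.eq_of_rank {W : Type} [LT W] [WellFoundedLT W]
    (r : ∀ b : D.Idx, D.carrier b → W)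
    (hr : ∀ (a b : D.Idx) (e : D.Edge a b), ∃ φ : Arrow (D.carrier a) (D.carrier b),
      D.map e = φ.apply ∧ φ.Lowers (r a) (r b))
    {s s' : ∀ i : D.Idx, Set (D.carrier i)} (hs : D.IsCrossSection s) (hs' : D.IsCrossSection s')
    (h : ∀ b, ¬ Nonempty (D.In b) → s b = s' b) (b : D.Idx) : s b = s' b := by
  -- The induction treats all members at once, since a map leads from one member to another and only
  -- the rank decreases.
  suffices H : ∀ (w : W) (b : D.Idx) (y : D.carrier b), r b y = w → (y ∈ s b ↔ y ∈ s' b) from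
    Set.ext fun y => H _ b y rfl
  intro w
  induction w using WellFoundedLT.induction with
  | ind w ih =>
    rintro b y rfl
    by_cases hb : Nonempty (D.In b)
    · have key : ∀ e : D.In b, y ∈ D.map e.2 (s e.1) ↔ y ∈ D.map e.2 (s' e.1) := by
        intro e
        obtain ⟨φ, hφ, hl⟩ := hr _ _ e.2
        rw [hφ]
        exact Arrow.mem_apply_congr hl fun x hx => ih _ hx _ x rfl
      by_cases hu : b ∈ D.unionIdx
      · rw [(hs b hb).2 hu, (hs' b hb).2 hu]
        simp only [Set.mem_iUnion, key]
      · rw [(hs b hb).1 hu, (hs' b hb).1 hu]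
        simp only [Set.mem_iInter, key]
    · rw [h b hb]

/-- A cross section, given by conditions on the single maps. -/
theorem isCrossSection_of_edges {s : ∀ i : D.Idx, Set (D.carrier i)}
    (hU : ∀ (a b : D.Idx) (e : D.Edge a b), b ∈ D.unionIdx → D.map e (s a) ⊆ s b)
    (hU' : ∀ b ∈ D.unionIdx, ∀ y ∈ s b, Nonempty (D.In b) →
      ∃ (a : D.Idx) (e : D.Edge a b), y ∈ D.map e (s a))
    (hI : ∀ (a b : D.Idx) (e : D.Edge a b), b ∉ D.unionIdx → s b ⊆ D.map e (s a))
    (hI' : ∀ b ∉ D.unionIdx, ∀ y,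
      (∀ (a : D.Idx) (e : D.Edge a b), y ∈ D.map e (s a)) → y ∈ s b) :
    D.IsCrossSection s := by
  intro b hb
  constructor
  · intro hu
    ext y
    simp only [Set.mem_iInter]
    exact ⟨fun hy e => hI _ _ e.2 hu hy, fun hy => hI' b hu y fun a e => hy ⟨a, e⟩⟩
  · intro hu
    ext y
    simp only [Set.mem_iUnion]
    constructor
    · intro hy
      obtain ⟨a, e, h⟩ := hU' b hu y hy hb
      exact ⟨⟨a, e⟩, h⟩
    · rintro ⟨e, h⟩
      exact hU _ _ e.2 hu h

/-- The maps form a nested dependent sum; a surjection from a plain finite type gives both its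
finiteness and the count. -/
theorem size_le_of_surjective {M : Set (Σ X Y : Type, X → Y)} {K : ℕ} {C : Type} [Fintype C]
    (g : C → D.Maps) (hg : Function.Surjective g)
    (hK : ∀ (a b : D.Idx) (e : D.Edge a b), powerMapSize M (D.map e) ≤ K) :
    D.size M ≤ (Fintype.card C * K : ℕ) := by
  classical
  have : Fintype D.Maps := Fintype.ofSurjective g hg
  unfold Diagram.size
  rw [tsum_fintype]
  calc ∑ e : D.Maps, powerMapSize M (D.map e.2.2)
      ≤ ∑ _e : D.Maps, (K : ℕ∞) := Finset.sum_le_sum fun e _ => hK _ _ _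
    _ = (Fintype.card D.Maps * K : ℕ) := by simp
    _ ≤ (Fintype.card C * K : ℕ) := by
        exact_mod_cast Nat.mul_le_mul_right K (Fintype.card_le_of_surjective g hg)

end Diagram

/-! ### Generated maps on natural numbers -/

section Generated

variable {X : Type} {f g : X → ℕ} {a b : ℕ}

theorem generated_zero : GeneratedWithSize natMaps (fun _ : X => 0) 3 :=
  GeneratedWithSize.comp (GeneratedWithSize.omega X)
    (GeneratedWithSize.base (fun _ : Fin 1 => (0 : ℕ)) (Or.inl rfl))

theorem generated_succ (hf : GeneratedWithSize natMaps f a) :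
    GeneratedWithSize natMaps (fun x => f x + 1) (1 + (1 + a)) :=
  GeneratedWithSize.comp hf (GeneratedWithSize.base Nat.succ (Or.inr rfl))

theorem generated_pair (hf : GeneratedWithSize natMaps f a) (hg : GeneratedWithSize natMaps g b) :
    GeneratedWithSize natMaps (fun x => ![f x, g x]) (1 + (a + b)) := by
  have := GeneratedWithSize.prod (M := natMaps) (n := 2) (by norm_num) (Y := fun _ => ℕ)
    (f := ![f, g]) (a := ![a, b]) (by intro i; fin_cases i <;> assumption)
  convert this using 1
  · ext x i
    fin_cases i <;> rfl
  · simp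

theorem generated_coord {n : ℕ} (i : Fin n) :
    GeneratedWithSize natMaps (fun y : Fin n → ℕ => y i) 1 :=
  GeneratedWithSize.proj (fun _ => ℕ) i

end Generated

theorem mem_image_pair {X : Type} {f g : X → ℕ} {S : Set X} {y : Fin 2 → ℕ} :
    y ∈ (fun x => ![f x, g x]) '' S ↔ ∃ x ∈ S, f x = y 0 ∧ g x = y 1 := by
  simp only [Set.mem_image, funext_iff, Fin.forall_fin_two]
  rfl

/-! ### The diagram of a computation -/

namespace TuringMachine

variable (M : TuringMachine) (p : List (Fin 2))

/-- The states in which the machine does not stop. -/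
def Live : Type := {q : M.Q // q ≠ M.qA ∧ q ≠ M.qR}

/-- The members of the diagram of the computation of `M` on input `p`. In pairs of natural numbers
the first component is a time, the second a position on the tape. -/
inductive Node : Type
  /-- the one-point set -/
  | one
  /-- all natural numbers -/
  | nat
  /-- no natural number -/
  | empty
  /-- the pairs of distinct natural numbers -/
  | ne
  /-- the position `i` -/
  | pos (i : Fin (p.length + 1))
  /-- the positions behind the input -/
  | tail
  /-- the symbol `a` is on the tape -/
  | sym (a : M.Θ)
  /-- the head is there, in state `q` -/
  | head (q : M.Q)
  /-- the head reads the symbol `b` in the state `q` -/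
  | read (b : M.Θ) (q : M.Live)
  /-- the head reads `b` in the state `q`, one cell to the right -/
  | readRight (b : M.Θ) (q : M.Live)
  /-- the head reads `b` in the state `q` at the leftmost cell -/
  | readZero (b : M.Θ) (q : M.Live)
  /-- the head is there, in a live state -/
  | live
  /-- the triples of a time, a position and a different head position -/
  | away
  /-- the head is elsewhere, in a live state -/
  | idle
  /-- the symbol `a` is on the tape and the head is elsewhere, in a live state -/
  | keep (a : M.Θ)
  /-- the time of acceptance -/
  | time
  /-- the symbol `a` is on the tape at the time of acceptance -/
  | final (a : M.Θ)
  /-- the positions up to the length of the output -/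
  | upto
  /-- the length of the output, at the time of acceptance -/
  | len
  /-- the output -/
  | out

variable {M p}

namespace Node

/-- The sets of the diagram. -/
def Carrier : Node M p → Type
  | one => Fin 1
  | nat => ℕ
  | empty => ℕ
  | pos _ => ℕ
  | tail => ℕ
  | readZero _ _ => ℕ
  | time => ℕ
  | upto => ℕ
  | away => Fin 3 → ℕ
  | ne => Fin 2 → ℕ
  | sym _ => Fin 2 → ℕ
  | head _ => Fin 2 → ℕ
  | read _ _ => Fin 2 → ℕ
  | readRight _ _ => Fin 2 → ℕ
  | live => Fin 2 → ℕ
  | idle => Fin 2 → ℕ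
  | keep _ => Fin 2 → ℕ
  | final _ => Fin 2 → ℕ
  | len => Fin 2 → ℕ
  | out => Fin 2 → ℕ

/-- The members at which the intersection of the incoming maps is taken. -/
def IsInter : Node M p → Prop
  | read _ _ => True
  | away => True
  | keep _ => True
  | final _ => True
  | len => True
  | _ => False

/-- The maps of the diagram. -/
inductive Edge : Node M p → Node M p → Type
  | natOne : Edge one nat
  | emptySelf : Edge empty empty
  | neLeft : Edge nat ne
  | neRight : Edge nat ne
  | neSelf : Edge ne ne
  | posZero : Edge one (pos 0)
  | posSucc (i : Fin p.length) : Edge (pos i.castSucc) (pos i.succ)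
  | tailPos : Edge (pos (Fin.last _)) tail
  | tailSelf : Edge tail tail
  | symInput (i : Fin p.length) : Edge (pos i.castSucc) (sym (M.bit (p.get i)))
  | symBlank : Edge tail (sym M.blank)
  | symWrite (b : M.Θ) (q : M.Live) : Edge (read b q) (sym (M.δ (b, q.1)).1)
  | symKeep (a : M.Θ) : Edge (keep a) (sym a)
  | headInit : Edge one (head M.q₀)
  | headEmpty (q : M.Q) : Edge empty (head q)
  | headRight (b : M.Θ) (q : M.Live) : Edge (readRight b q) (head (M.δ (b, q.1)).2.1)
  | headZero (b : M.Θ) (q : M.Live) : Edge (readZero b q) (head (M.δ (b, q.1)).2.1)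
  | readSym (b : M.Θ) (q : M.Live) : Edge (sym b) (read b q)
  | readHead (b : M.Θ) (q : M.Live) : Edge (head q.1) (read b q)
  | rightRead (b : M.Θ) (q : M.Live) : Edge (read b q) (readRight b q)
  | zeroRead (b : M.Θ) (q : M.Live) : Edge (read b q) (readZero b q)
  | liveEmpty : Edge empty live
  | liveHead (q : M.Live) : Edge (head q.1) live
  | awayNe : Edge ne away
  | awayLive : Edge live away
  | idleAway : Edge away idle
  | keepSym (a : M.Θ) : Edge (sym a) (keep a)
  | keepIdle (a : M.Θ) : Edge idle (keep a)
  | timeHead : Edge (head M.qA) time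
  | finalSym (a : M.Θ) : Edge (sym a) (final a)
  | finalTime (a : M.Θ) : Edge time (final a)
  | uptoZero : Edge one upto
  | uptoFinal (v : Fin 2) : Edge (final (M.bit v)) upto
  | lenFinal : Edge (final M.blank) len
  | lenUpto : Edge upto len
  | outFinal (v : Fin 2) : Edge (final (M.bit v)) out
  | outLen (v : Fin 2) : Edge len out

/-- The arrow that belongs to a map of the diagram. -/
def Edge.arrow : ∀ {a b : Node M p}, Edge a b → Arrow a.Carrier b.Carrier
  | _, _, natOne => .preimage fun _ : ℕ => (0 : Fin 1)
  -- Only the empty set equals its own image under the successor.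
  | _, _, emptySelf => .image fun j : ℕ => j + 1
  -- Inequality without complements: the two axes without the origin, closed under the diagonal
  -- shift.
  | _, _, neLeft => .image fun j : ℕ => ![0, j + 1]
  | _, _, neRight => .image fun j : ℕ => ![j + 1, 0]
  | _, _, neSelf => .image fun y : Fin 2 → ℕ => ![y 0 + 1, y 1 + 1]
  | _, _, posZero => .image fun _ : Fin 1 => (0 : ℕ)
  | _, _, posSucc _ => .image fun j : ℕ => j + 1
  | _, _, tailPos => .image fun j : ℕ => j
  | _, _, tailSelf => .image fun j : ℕ => j + 1
  | _, _, symInput _ => .image fun j : ℕ => ![0, j]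
  | _, _, symBlank => .image fun j : ℕ => ![0, j]
  | _, _, symWrite _ _ => .image fun y : Fin 2 → ℕ => ![y 0 + 1, y 1]
  | _, _, symKeep _ => .image fun y : Fin 2 → ℕ => ![y 0 + 1, y 1]
  | _, _, headInit => .image fun _ : Fin 1 => ![0, 0]
  -- This adds no element; it only ensures that a state which no transition enters still has an
  -- incoming map.
  | _, _, headEmpty _ => .image fun j : ℕ => ![j, j]
  -- The argument is the cell to the left of the head, so a left move ends at `y 1` and a right move
  -- two cells further. The leftmost head position is left to `headZero`.
  | _, _, headRight b q => .image fun y : Fin 2 → ℕ =>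
      ![y 0 + 1, if (M.δ (b, q.1)).2.2 = 0 then y 1 else y 1 + 1 + 1]
  | _, _, headZero b q => .image fun j : ℕ =>
      ![j + 1, if (M.δ (b, q.1)).2.2 = 0 then 0 else 0 + 1]
  | _, _, readSym _ _ => .image fun y : Fin 2 → ℕ => y
  | _, _, readHead _ _ => .image fun y : Fin 2 → ℕ => y
  | _, _, rightRead _ _ => .preimage fun y : Fin 2 → ℕ => ![y 0, y 1 + 1]
  | _, _, zeroRead _ _ => .preimage fun j : ℕ => ![j, 0]
  | _, _, liveEmpty => .image fun j : ℕ => ![j, j]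
  | _, _, liveHead _ => .image fun y : Fin 2 → ℕ => y
  -- The third coordinate is the position of the head; the projection to `idle` then acts as an
  -- existential quantifier.
  | _, _, awayNe => .preimage fun y : Fin 3 → ℕ => ![y 1, y 2]
  | _, _, awayLive => .preimage fun y : Fin 3 → ℕ => ![y 0, y 2]
  | _, _, idleAway => .image fun y : Fin 3 → ℕ => ![y 0, y 1]
  | _, _, keepSym _ => .image fun y : Fin 2 → ℕ => y
  | _, _, keepIdle _ => .image fun y : Fin 2 → ℕ => y
  | _, _, timeHead => .image fun y : Fin 2 → ℕ => y 0
  | _, _, finalSym _ => .image fun y : Fin 2 → ℕ => y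
  | _, _, finalTime _ => .preimage fun y : Fin 2 → ℕ => y 0
  | _, _, uptoZero => .image fun _ : Fin 1 => (0 : ℕ)
  | _, _, uptoFinal _ => .image fun y : Fin 2 → ℕ => y 1 + 1
  | _, _, lenFinal => .image fun y : Fin 2 → ℕ => y
  | _, _, lenUpto => .preimage fun y : Fin 2 → ℕ => y 1
  | _, _, outFinal v => .image fun y : Fin 2 → ℕ => ![y 1, (v : ℕ)]
  | _, _, outLen v => .image fun y : Fin 2 → ℕ => ![y 1, (v : ℕ)]

/-! ### Sizes of the maps of the diagram. -/

theorem generated_bit {X : Type} (v : Fin 2) :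
    ∃ n ≤ 5, GeneratedWithSize natMaps (fun _ : X => (v : ℕ)) n := by
  fin_cases v
  · exact ⟨_, by norm_num, generated_zero⟩
  · exact ⟨_, by norm_num, generated_succ generated_zero⟩

theorem Edge.arrow_generatedWithin {a b : Node M p} (e : Edge a b) :
    e.arrow.GeneratedWithin natMaps 20 := by
  have hid : ∀ X : Type, ∃ n ≤ 20, GeneratedWithSize natMaps (fun x : X => x) n :=
    fun X => ⟨1, by norm_num, .ident X⟩
  cases e with
  | natOne => exact ⟨_, by norm_num, .omega _⟩
  | emptySelf => exact ⟨_, by norm_num, generated_succ (.ident _)⟩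
  | neLeft => exact ⟨_, by norm_num, generated_pair generated_zero (generated_succ (.ident _))⟩
  | neRight => exact ⟨_, by norm_num, generated_pair (generated_succ (.ident _)) generated_zero⟩
  | neSelf => exact ⟨_, by norm_num, generated_pair (generated_succ (generated_coord 0))
      (generated_succ (generated_coord 1))⟩
  | posZero => exact ⟨_, by norm_num, generated_zero⟩
  | posSucc => exact ⟨_, by norm_num, generated_succ (.ident _)⟩
  | tailPos => exact hid _
  | tailSelf => exact ⟨_, by norm_num, generated_succ (.ident _)⟩
  | symInput => exact ⟨_, by norm_num, generated_pair generated_zero (.ident _)⟩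
  | symBlank => exact ⟨_, by norm_num, generated_pair generated_zero (.ident _)⟩
  | symWrite | symKeep => exact ⟨_, by norm_num,
      generated_pair (generated_succ (generated_coord 0)) (generated_coord 1)⟩
  | headInit => exact ⟨_, by norm_num, generated_pair generated_zero generated_zero⟩
  | headEmpty => exact ⟨_, by norm_num, generated_pair (.ident _) (.ident _)⟩
  | headRight b q =>
    change ∃ n ≤ 20, GeneratedWithSize natMaps (fun y : Fin 2 → ℕ =>
      ![y 0 + 1, if (M.δ (b, q.1)).2.2 = 0 then y 1 else y 1 + 1 + 1]) n
    split_ifs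
    · exact ⟨_, by norm_num,
        generated_pair (generated_succ (generated_coord 0)) (generated_coord 1)⟩
    · exact ⟨_, by norm_num, generated_pair (generated_succ (generated_coord 0))
        (generated_succ (generated_succ (generated_coord 1)))⟩
  | headZero b q =>
    change ∃ n ≤ 20, GeneratedWithSize natMaps (fun j : ℕ =>
      ![j + 1, if (M.δ (b, q.1)).2.2 = 0 then 0 else 0 + 1]) n
    split_ifs
    · exact ⟨_, by norm_num, generated_pair (generated_succ (.ident _)) generated_zero⟩
    · exact ⟨_, by norm_num,
        generated_pair (generated_succ (.ident _)) (generated_succ generated_zero)⟩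
  | readSym | readHead | liveHead | keepSym | keepIdle | finalSym | lenFinal => exact hid _
  | rightRead => exact ⟨_, by norm_num,
      generated_pair (generated_coord 0) (generated_succ (generated_coord 1))⟩
  | zeroRead => exact ⟨_, by norm_num, generated_pair (.ident _) generated_zero⟩
  | liveEmpty => exact ⟨_, by norm_num, generated_pair (.ident _) (.ident _)⟩
  | awayNe | awayLive | idleAway =>
    exact ⟨_, by norm_num, generated_pair (generated_coord _) (generated_coord _)⟩
  | timeHead | finalTime | lenUpto => exact ⟨_, by norm_num, generated_coord _⟩
  | uptoZero => exact ⟨_, by norm_num, generated_zero⟩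
  | uptoFinal => exact ⟨_, by norm_num, generated_succ (generated_coord 1)⟩
  | outFinal v | outLen v =>
    obtain ⟨n, hn, h⟩ := generated_bit (X := Fin 2 → ℕ) v
    exact ⟨_, by omega, generated_pair (generated_coord 1) h⟩

/-! ### The rank that forces uniqueness. -/

/-- A rank of the elements of the members of the diagram that is lowered by all of its maps. -/
def rank : ∀ b : Node M p, b.Carrier → ℕ ×ₗ ℕ
  | one => fun _ => toLex (0, 0)
  | nat => fun _ => toLex (0, 1)
  | empty => fun j : ℕ => toLex (0, j)
  | pos i => fun _ => toLex (0, i + 1)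
  | tail => fun j : ℕ => toLex (1, j)
  | ne => fun y : Fin 2 → ℕ => toLex (1, y 0)
  -- One time step passes through five levels: tape and head; reading; shifted reading and `away`;
  -- `idle`; `keep`. The factor 5 puts time `t + 1` above all of them.
  | sym _ => fun y : Fin 2 → ℕ => toLex (2, 5 * y 0)
  | head _ => fun y : Fin 2 → ℕ => toLex (2, 5 * y 0)
  | read _ _ => fun y : Fin 2 → ℕ => toLex (2, 5 * y 0 + 1)
  | readRight _ _ => fun y : Fin 2 → ℕ => toLex (2, 5 * y 0 + 2)
  | readZero _ _ => fun j : ℕ => toLex (2, 5 * j + 2)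
  | live => fun y : Fin 2 → ℕ => toLex (2, 5 * y 0 + 1)
  | away => fun y : Fin 3 → ℕ => toLex (2, 5 * y 0 + 2)
  | idle => fun y : Fin 2 → ℕ => toLex (2, 5 * y 0 + 3)
  | keep _ => fun y : Fin 2 → ℕ => toLex (2, 5 * y 0 + 4)
  -- No loops occur from here on, so a stage number suffices. The lexicographic order is needed
  -- because dropping the time coordinate makes a value depend on unboundedly many times.
  | time => fun _ => toLex (3, 0)
  | final _ => fun _ => toLex (4, 0)
  | upto => fun _ => toLex (5, 0)
  | len => fun _ => toLex (6, 0)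
  | out => fun _ => toLex (7, 0)

theorem Edge.arrow_lowers {a b : Node M p} (e : Edge a b) :
    e.arrow.Lowers a.rank b.rank := by
  cases e <;> intro x <;> simp [rank, Prod.Lex.toLex_lt_toLex] <;> omega

end Node

variable (M p) in
/-- The diagram of the computation of `M` on input `p`. -/
def diagram : Diagram where
  Idx := Node M p
  carrier := Node.Carrier
  unionIdx := {b | ¬ b.IsInter}
  Edge := Node.Edge
  map e := e.arrow.apply

theorem generatedBy_diagram : (diagram M p).GeneratedBy natMaps :=
  fun _ _ e => Arrow.generated (Node.Edge.arrow_generatedWithin e)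

/-- A member without incoming maps would be unconstrained and destroy uniqueness. The maps out of
`empty` serve this purpose, also for machines without live states. -/
theorem nonempty_in {b : Node M p} (hb : b ≠ .one) : Nonempty ((diagram M p).In b) := by
  cases b with
  | one => exact absurd rfl hb
  | nat => exact ⟨_, Node.Edge.natOne⟩
  | empty => exact ⟨_, Node.Edge.emptySelf⟩
  | ne => exact ⟨_, Node.Edge.neSelf⟩
  | pos i =>
    induction i using Fin.cases with
    | zero => exact ⟨_, Node.Edge.posZero⟩
    | succ i => exact ⟨_, Node.Edge.posSucc i⟩
  | tail => exact ⟨_, Node.Edge.tailSelf⟩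
  | sym a => exact ⟨_, Node.Edge.symKeep a⟩
  | head q => exact ⟨_, Node.Edge.headEmpty q⟩
  | read b q => exact ⟨_, Node.Edge.readSym b q⟩
  | readRight b q => exact ⟨_, Node.Edge.rightRead b q⟩
  | readZero b q => exact ⟨_, Node.Edge.zeroRead b q⟩
  | live => exact ⟨_, Node.Edge.liveEmpty⟩
  | away => exact ⟨_, Node.Edge.awayNe⟩
  | idle => exact ⟨_, Node.Edge.idleAway⟩
  | keep a => exact ⟨_, Node.Edge.keepSym a⟩
  | time => exact ⟨_, Node.Edge.timeHead⟩
  | final a => exact ⟨_, Node.Edge.finalSym a⟩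
  | upto => exact ⟨_, Node.Edge.uptoZero⟩
  | len => exact ⟨_, Node.Edge.lenUpto⟩
  | out => exact ⟨_, Node.Edge.outLen 0⟩

/-! ### Counting the maps. -/

/-- A finite type that indexes the maps of the diagram. -/
abbrev Code (M : TuringMachine) (p : List (Fin 2)) : Type :=
  (Fin 18 ⊕ Fin 6) ⊕ (Fin 2 × Fin p.length) ⊕ (Fin 5 × M.Θ) ⊕ (M.Live ⊕ M.Q) ⊕
    (Fin 7 × M.Θ × M.Live)

/-- The map with a given code. -/
def decode : Code M p → (diagram M p).Maps
  | .inl (.inl 0) => ⟨_, _, Node.Edge.natOne⟩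
  | .inl (.inl 1) => ⟨_, _, Node.Edge.emptySelf⟩
  | .inl (.inl 2) => ⟨_, _, Node.Edge.neLeft⟩
  | .inl (.inl 3) => ⟨_, _, Node.Edge.neRight⟩
  | .inl (.inl 4) => ⟨_, _, Node.Edge.neSelf⟩
  | .inl (.inl 5) => ⟨_, _, Node.Edge.posZero⟩
  | .inl (.inl 6) => ⟨_, _, Node.Edge.tailPos⟩
  | .inl (.inl 7) => ⟨_, _, Node.Edge.tailSelf⟩
  | .inl (.inl 8) => ⟨_, _, Node.Edge.symBlank⟩
  | .inl (.inl 9) => ⟨_, _, Node.Edge.headInit⟩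
  | .inl (.inl 10) => ⟨_, _, Node.Edge.liveEmpty⟩
  | .inl (.inl 11) => ⟨_, _, Node.Edge.awayNe⟩
  | .inl (.inl 12) => ⟨_, _, Node.Edge.awayLive⟩
  | .inl (.inl 13) => ⟨_, _, Node.Edge.idleAway⟩
  | .inl (.inl 14) => ⟨_, _, Node.Edge.timeHead⟩
  | .inl (.inl 15) => ⟨_, _, Node.Edge.uptoZero⟩
  | .inl (.inl 16) => ⟨_, _, Node.Edge.lenFinal⟩
  | .inl (.inl _) => ⟨_, _, Node.Edge.lenUpto⟩
  | .inl (.inr 0) => ⟨_, _, Node.Edge.uptoFinal 0⟩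
  | .inl (.inr 1) => ⟨_, _, Node.Edge.uptoFinal 1⟩
  | .inl (.inr 2) => ⟨_, _, Node.Edge.outFinal 0⟩
  | .inl (.inr 3) => ⟨_, _, Node.Edge.outFinal 1⟩
  | .inl (.inr 4) => ⟨_, _, Node.Edge.outLen 0⟩
  | .inl (.inr 5) => ⟨_, _, Node.Edge.outLen 1⟩
  | .inr (.inl (0, i)) => ⟨_, _, Node.Edge.posSucc i⟩
  | .inr (.inl (1, i)) => ⟨_, _, Node.Edge.symInput i⟩
  | .inr (.inr (.inl (0, a))) => ⟨_, _, Node.Edge.symKeep a⟩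
  | .inr (.inr (.inl (1, a))) => ⟨_, _, Node.Edge.keepSym a⟩
  | .inr (.inr (.inl (2, a))) => ⟨_, _, Node.Edge.keepIdle a⟩
  | .inr (.inr (.inl (3, a))) => ⟨_, _, Node.Edge.finalSym a⟩
  | .inr (.inr (.inl (4, a))) => ⟨_, _, Node.Edge.finalTime a⟩
  | .inr (.inr (.inr (.inl (.inl q)))) => ⟨_, _, Node.Edge.liveHead q⟩
  | .inr (.inr (.inr (.inl (.inr q)))) => ⟨_, _, Node.Edge.headEmpty q⟩
  | .inr (.inr (.inr (.inr (0, b, q)))) => ⟨_, _, Node.Edge.symWrite b q⟩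
  | .inr (.inr (.inr (.inr (1, b, q)))) => ⟨_, _, Node.Edge.headRight b q⟩
  | .inr (.inr (.inr (.inr (2, b, q)))) => ⟨_, _, Node.Edge.headZero b q⟩
  | .inr (.inr (.inr (.inr (3, b, q)))) => ⟨_, _, Node.Edge.readSym b q⟩
  | .inr (.inr (.inr (.inr (4, b, q)))) => ⟨_, _, Node.Edge.readHead b q⟩
  | .inr (.inr (.inr (.inr (5, b, q)))) => ⟨_, _, Node.Edge.rightRead b q⟩
  | .inr (.inr (.inr (.inr (6, b, q)))) => ⟨_, _, Node.Edge.zeroRead b q⟩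

theorem decode_surjective : Function.Surjective (decode (M := M) (p := p)) := by
  rintro ⟨b, a, e⟩
  cases e with
  | natOne => exact ⟨.inl (.inl 0), rfl⟩
  | emptySelf => exact ⟨.inl (.inl 1), rfl⟩
  | neLeft => exact ⟨.inl (.inl 2), rfl⟩
  | neRight => exact ⟨.inl (.inl 3), rfl⟩
  | neSelf => exact ⟨.inl (.inl 4), rfl⟩
  | posZero => exact ⟨.inl (.inl 5), rfl⟩
  | posSucc i => exact ⟨.inr (.inl (0, i)), rfl⟩
  | tailPos => exact ⟨.inl (.inl 6), rfl⟩
  | tailSelf => exact ⟨.inl (.inl 7), rfl⟩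
  | symInput i => exact ⟨.inr (.inl (1, i)), rfl⟩
  | symBlank => exact ⟨.inl (.inl 8), rfl⟩
  | symWrite b q => exact ⟨.inr (.inr (.inr (.inr (0, b, q)))), rfl⟩
  | symKeep a => exact ⟨.inr (.inr (.inl (0, a))), rfl⟩
  | headInit => exact ⟨.inl (.inl 9), rfl⟩
  | headEmpty q => exact ⟨.inr (.inr (.inr (.inl (.inr q)))), rfl⟩
  | headRight b q => exact ⟨.inr (.inr (.inr (.inr (1, b, q)))), rfl⟩
  | headZero b q => exact ⟨.inr (.inr (.inr (.inr (2, b, q)))), rfl⟩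
  | readSym b q => exact ⟨.inr (.inr (.inr (.inr (3, b, q)))), rfl⟩
  | readHead b q => exact ⟨.inr (.inr (.inr (.inr (4, b, q)))), rfl⟩
  | rightRead b q => exact ⟨.inr (.inr (.inr (.inr (5, b, q)))), rfl⟩
  | zeroRead b q => exact ⟨.inr (.inr (.inr (.inr (6, b, q)))), rfl⟩
  | liveEmpty => exact ⟨.inl (.inl 10), rfl⟩
  | liveHead q => exact ⟨.inr (.inr (.inr (.inl (.inl q)))), rfl⟩
  | awayNe => exact ⟨.inl (.inl 11), rfl⟩
  | awayLive => exact ⟨.inl (.inl 12), rfl⟩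
  | idleAway => exact ⟨.inl (.inl 13), rfl⟩
  | keepSym a => exact ⟨.inr (.inr (.inl (1, a))), rfl⟩
  | keepIdle a => exact ⟨.inr (.inr (.inl (2, a))), rfl⟩
  | timeHead => exact ⟨.inl (.inl 14), rfl⟩
  | finalSym a => exact ⟨.inr (.inr (.inl (3, a))), rfl⟩
  | finalTime a => exact ⟨.inr (.inr (.inl (4, a))), rfl⟩
  | uptoZero => exact ⟨.inl (.inl 15), rfl⟩
  | uptoFinal v =>
    fin_cases v
    · exact ⟨.inl (.inr 0), rfl⟩
    · exact ⟨.inl (.inr 1), rfl⟩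
  | lenFinal => exact ⟨.inl (.inl 16), rfl⟩
  | lenUpto => exact ⟨.inl (.inl 17), rfl⟩
  | outFinal v =>
    fin_cases v
    · exact ⟨.inl (.inr 2), rfl⟩
    · exact ⟨.inl (.inr 3), rfl⟩
  | outLen v =>
    fin_cases v
    · exact ⟨.inl (.inr 4), rfl⟩
    · exact ⟨.inl (.inr 5), rfl⟩

theorem numSymbols_pos (M : TuringMachine) : 0 < M.numSymbols :=
  letI := M.finΘ
  Fintype.card_pos_iff.2 ⟨M.blank⟩

theorem numStates_pos (M : TuringMachine) : 0 < M.numStates :=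
  letI := M.finQ
  Fintype.card_pos_iff.2 ⟨M.q₀⟩

/-- With `N = |Θ_M| |Q_M| ≥ 1` there are at most `24 + 2|p| + 14N ≤ 40(|p| + N)` maps, each of size
at most 20. -/
theorem size_diagram_le :
    (diagram M p).size natMaps ≤ (800 * (p.length + M.numSymbols * M.numStates) : ℕ) := by
  let _ := M.finQ
  let _ := M.finΘ
  have _ : Fintype M.Live :=
    Fintype.ofInjective (Subtype.val : M.Live → M.Q) Subtype.val_injective
  refine (Diagram.size_le_of_surjective (K := 20) decode decode_surjective
    fun a b e => Arrow.powerMapSize_le (Node.Edge.arrow_generatedWithin e)).trans ?_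
  have hL : Fintype.card M.Live ≤ M.numStates :=
    Fintype.card_le_of_injective (Subtype.val : M.Live → M.Q) Subtype.val_injective
  have hΘ : Fintype.card M.Θ = M.numSymbols := rfl
  have hQ : Fintype.card M.Q = M.numStates := rfl
  have h1 := M.numSymbols_pos
  have h2 := M.numStates_pos
  simp only [Fintype.card_sum, Fintype.card_prod, Fintype.card_fin, hΘ, hQ, Nat.cast_le]
  have := Nat.mul_le_mul_left M.numSymbols hL
  have : M.numSymbols ≤ M.numSymbols * M.numStates := Nat.le_mul_of_pos_right _ h2
  have : M.numStates ≤ M.numSymbols * M.numStates := Nat.le_mul_of_pos_left _ h1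
  omega


/-! ### Runs and halting times. -/

variable (M p) in
/-- The configuration at time `t`. -/
noncomputable def config (t : ℕ) : M.Config := M.step^[t] (M.initial p)

theorem config_succ_of_live {t : ℕ} (hA : (config M p t).state ≠ M.qA)
    (hR : (config M p t).state ≠ M.qR) :
    (config M p (t + 1)).state =
        (M.δ ((config M p t).tape (config M p t).head, (config M p t).state)).2.1 ∧
      (config M p (t + 1)).head =
        (if (M.δ ((config M p t).tape (config M p t).head, (config M p t).state)).2.2 = 0
          then (config M p t).head - 1 else (config M p t).head + 1) ∧
      (config M p (t + 1)).tape = Function.update (config M p t).tape (config M p t).head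
        (M.δ ((config M p t).tape (config M p t).head, (config M p t).state)).1 := by
  have h : config M p (t + 1) = M.step (config M p t) := Function.iterate_succ_apply' ..
  rw [h, step, if_neg (by tauto)]
  exact ⟨rfl, rfl, rfl⟩

variable (M p) in
/-- The machine stops exactly at time `T`, in the accept state, with output `σ`. -/
structure AcceptsAt (T : ℕ) (σ : List (Fin 2)) : Prop where
  ne_accept : ∀ t < T, (config M p t).state ≠ M.qA
  ne_reject : ∀ t < T, (config M p t).state ≠ M.qR
  accept : (config M p T).state = M.qA
  tape_eq : (config M p T).tape = M.tapeOf σ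

/-- `T` is the first halting time. The configuration is constant from then on, so the accepting
configuration at the given time `k` is already the one at `T`. -/
theorem Outputs.exists_acceptsAt {σ : List (Fin 2)} (h : M.Outputs p σ) :
    ∃ T, AcceptsAt M p T σ := by
  classical
  obtain ⟨k, hk, hσ⟩ := h
  have hex : ∃ t, (config M p t).state = M.qA ∨ (config M p t).state = M.qR := ⟨k, Or.inl hk⟩
  have hfix : ∀ m, config M p (m + Nat.find hex) = config M p (Nat.find hex) := by
    intro m
    induction m with
    | zero => rw [Nat.zero_add]
    | succ m ih =>
      have h : config M p (m + 1 + Nat.find hex) = M.step (config M p (m + Nat.find hex)) := by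
        rw [Nat.add_right_comm]
        exact Function.iterate_succ_apply' ..
      rw [h, ih, step, if_pos (Nat.find_spec hex)]
  have hle : Nat.find hex ≤ k := Nat.find_min' hex (Or.inl hk)
  have hT : config M p k = config M p (Nat.find hex) := by
    rw [← hfix (k - Nat.find hex), Nat.sub_add_cancel hle]
  refine ⟨Nat.find hex, fun t ht h => Nat.find_min hex ht (Or.inl h),
    fun t ht h => Nat.find_min hex ht (Or.inr h), ?_, ?_⟩
  · rw [← hT]; exact hk
  · rw [← hT]; exact hσ

theorem tapeOf_eq_bit {σ : List (Fin 2)} {i : ℕ} {v : Fin 2} :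
    M.tapeOf σ i = M.bit v ↔ ∃ h : i < σ.length, σ.get ⟨i, h⟩ = v := by
  unfold tapeOf
  split_ifs with h
  · simp [h]
  · simp [h, (M.bit_ne_blank v).symm]

theorem tapeOf_eq_blank {σ : List (Fin 2)} {i : ℕ} :
    M.tapeOf σ i = M.blank ↔ σ.length ≤ i := by
  unfold tapeOf
  split_ifs with h
  · simp [h, M.bit_ne_blank]
  · simpa using h

/-! ### The run as the unique cross section. -/

variable (M p) in
/-- The cross section of the diagram. -/
def computation (T : ℕ) (σ : List (Fin 2)) : ∀ b : Node M p, Set b.Carrier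
  | .one => Set.univ
  | .nat => Set.univ
  | .empty => (∅ : Set ℕ)
  | .pos i => {j : ℕ | j = i}
  | .tail => {j : ℕ | p.length ≤ j}
  | .readZero b q => {t : ℕ | t < T ∧ (config M p t).tape 0 = b ∧
      (config M p t).state = q.1 ∧ (config M p t).head = 0}
  | .time => {t : ℕ | t = T}
  | .upto => {j : ℕ | j ≤ σ.length}
  | .away => {y : Fin 3 → ℕ | y 1 ≠ y 2 ∧ y 0 < T ∧ (config M p (y 0)).head = y 2}
  | .ne => {y : Fin 2 → ℕ | y 0 ≠ y 1}
  -- Tape and head are recorded up to and including `T`; the sets that feed a transition require a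
  -- time below `T`, because no step is taken at `T`.
  | .sym a => {y : Fin 2 → ℕ | y 0 ≤ T ∧ (config M p (y 0)).tape (y 1) = a}
  | .head q => {y : Fin 2 → ℕ | y 0 ≤ T ∧ (config M p (y 0)).state = q ∧
      (config M p (y 0)).head = y 1}
  | .read b q => {y : Fin 2 → ℕ | y 0 < T ∧ (config M p (y 0)).tape (y 1) = b ∧
      (config M p (y 0)).state = q.1 ∧ (config M p (y 0)).head = y 1}
  | .readRight b q => {y : Fin 2 → ℕ | y 0 < T ∧ (config M p (y 0)).tape (y 1 + 1) = b ∧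
      (config M p (y 0)).state = q.1 ∧ (config M p (y 0)).head = y 1 + 1}
  | .live => {y : Fin 2 → ℕ | y 0 < T ∧ (config M p (y 0)).head = y 1}
  | .idle => {y : Fin 2 → ℕ | y 0 < T ∧ (config M p (y 0)).head ≠ y 1}
  | .keep a => {y : Fin 2 → ℕ | y 0 < T ∧ (config M p (y 0)).tape (y 1) = a ∧
      (config M p (y 0)).head ≠ y 1}
  | .final a => {y : Fin 2 → ℕ | y 0 = T ∧ M.tapeOf σ (y 1) = a}
  | .len => {y : Fin 2 → ℕ | y 0 = T ∧ y 1 = σ.length}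
  | .out => stringSet σ

section

variable {T : ℕ} {σ : List (Fin 2)}

theorem AcceptsAt.config_succ (h : AcceptsAt M p T σ) {t : ℕ} (ht : t < T) {b : M.Θ} {q : M.Q}
    {i : ℕ} (hb : (config M p t).tape i = b) (hq : (config M p t).state = q)
    (hi : (config M p t).head = i) :
    (config M p (t + 1)).state = (M.δ (b, q)).2.1 ∧
      (config M p (t + 1)).head = (if (M.δ (b, q)).2.2 = 0 then i - 1 else i + 1) ∧
      (config M p (t + 1)).tape = Function.update (config M p t).tape i (M.δ (b, q)).1 := by
  subst hi hb hq
  exact config_succ_of_live (h.ne_accept t ht) (h.ne_reject t ht)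

theorem AcceptsAt.lt_of_live (h : AcceptsAt M p T σ) {t : ℕ} (ht : t ≤ T) (q : M.Live)
    (hq : (config M p t).state = q.1) : t < T := by
  refine lt_of_le_of_ne ht ?_
  rintro rfl
  exact q.2.1 (hq.symm.trans h.accept)

theorem AcceptsAt.exists_live (h : AcceptsAt M p T σ) {t : ℕ} (ht : t < T) :
    ∃ q : M.Live, (config M p t).state = q.1 :=
  ⟨⟨_, h.ne_accept t ht, h.ne_reject t ht⟩, rfl⟩

/-- The two alternatives match the two kinds of maps into `out`: a bit of the final tape, or the end
marker with either value. -/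
theorem mem_stringSet {y : Fin 2 → ℕ} : y ∈ stringSet σ ↔
    (∃ v : Fin 2, (∃ h : y 0 < σ.length, σ.get ⟨y 0, h⟩ = v) ∧ (v : ℕ) = y 1) ∨
      ∃ v : Fin 2, y 0 = σ.length ∧ (v : ℕ) = y 1 := by
  simp only [stringSet, Set.mem_union, Set.mem_ofPred_eq, Set.mem_insert_iff,
    Set.mem_singleton_iff, funext_iff, Fin.forall_fin_two, Fin.exists_fin_two]
  refine or_congr ?_ ?_
  · constructor
    · rintro ⟨i, h0, h1⟩
      have h0 : y 0 = i := h0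
      have h1 : y 1 = (σ.get i : ℕ) := h1
      have : i = ⟨y 0, h0 ▸ i.2⟩ := Fin.ext h0.symm
      rw [← Fin.exists_fin_two (p := fun v : Fin 2 =>
        (∃ h : y 0 < σ.length, σ.get ⟨y 0, h⟩ = v) ∧ (v : ℕ) = y 1)]
      exact ⟨σ.get i, ⟨h0 ▸ i.2, by rw [← this]⟩, h1.symm⟩
    · rintro (⟨⟨h, h'⟩, hv⟩ | ⟨⟨h, h'⟩, hv⟩) <;>
      · refine ⟨⟨y 0, h⟩, rfl, ?_⟩
        rw [h']
        exact hv.symm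
  · simp [eq_comm]

/-- At unions the run is closed under the maps. For the transitions this is one step of the machine,
available since all times involved are below `T`. -/
theorem AcceptsAt.image_subset (h : AcceptsAt M p T σ) {a b : Node M p} (e : Node.Edge a b)
    (hb : ¬ b.IsInter) : e.arrow.apply (computation M p T σ a) ⊆ computation M p T σ b := by
  cases e with
  | natOne => exact fun _ _ => trivial
  | emptySelf => rintro _ ⟨j, hj, rfl⟩; exact hj
  | neLeft => rintro _ ⟨j, hj, rfl⟩; exact (Nat.succ_ne_zero j).symm
  | neRight => rintro _ ⟨j, hj, rfl⟩; exact Nat.succ_ne_zero j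
  | neSelf => rintro _ ⟨j, hj, rfl⟩; exact fun h => hj (Nat.succ_injective h)
  | posZero => rintro _ ⟨j, hj, rfl⟩; rfl
  | posSucc i => rintro _ ⟨j, hj, rfl⟩; exact congrArg Nat.succ hj
  | tailPos => rintro _ ⟨j, hj, rfl⟩; exact (hj : j = p.length).ge
  | tailSelf => rintro _ ⟨j, hj, rfl⟩; exact Nat.le_succ_of_le hj
  | symInput i =>
    rintro _ ⟨j, hj, rfl⟩
    change ℕ at j
    obtain rfl : j = (i : ℕ) := hj
    exact ⟨Nat.zero_le _, tapeOf_eq_bit.2 ⟨i.2, rfl⟩⟩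
  | symBlank =>
    rintro _ ⟨j, hj, rfl⟩
    exact ⟨Nat.zero_le _, tapeOf_eq_blank.2 hj⟩
  | symWrite b q =>
    rintro _ ⟨y, ⟨h1, h2, h3, h4⟩, rfl⟩
    refine ⟨h1, ?_⟩
    change (config M p (y 0 + 1)).tape (y 1) = _
    rw [(h.config_succ h1 h2 h3 h4).2.2, Function.update_self]
  | symKeep a =>
    rintro _ ⟨y, ⟨h1, h2, h3⟩, rfl⟩
    refine ⟨h1, ?_⟩
    change (config M p (y 0 + 1)).tape (y 1) = _
    rw [(h.config_succ h1 rfl rfl rfl).2.2, Function.update_of_ne h3.symm, h2]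
  | headInit =>
    rintro _ ⟨j, hj, rfl⟩
    exact ⟨Nat.zero_le _, rfl, rfl⟩
  | headEmpty q => rintro _ ⟨j, hj, rfl⟩; exact hj.elim
  | headRight b q =>
    rintro _ ⟨y, ⟨h1, h2, h3, h4⟩, rfl⟩
    obtain ⟨e1, e2, -⟩ := h.config_succ h1 h2 h3 h4
    exact ⟨h1, e1, e2⟩
  | headZero b q =>
    rintro _ ⟨t, ⟨h1, h2, h3, h4⟩, rfl⟩
    obtain ⟨e1, e2, -⟩ := h.config_succ h1 h2 h3 h4
    exact ⟨h1, e1, e2⟩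
  | readSym | readHead | awayNe | awayLive | keepSym | keepIdle | finalSym | finalTime | lenFinal
    | lenUpto => exact absurd trivial hb
  | rightRead b q => exact fun y hy => hy
  | zeroRead b q => exact fun y hy => hy
  | liveEmpty => rintro _ ⟨j, hj, rfl⟩; exact hj.elim
  | liveHead q =>
    rintro _ ⟨y, ⟨h1, h2, h3⟩, rfl⟩
    exact ⟨h.lt_of_live h1 q h2, h3⟩
  | idleAway =>
    rintro _ ⟨y, ⟨h1, h2, h3⟩, rfl⟩
    exact ⟨h2, fun h4 => h1 (h4.symm.trans h3)⟩
  | timeHead =>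
    rintro _ ⟨y, ⟨h1, h2, h3⟩, rfl⟩
    exact le_antisymm h1 (le_of_not_gt fun h4 => h.ne_accept _ h4 h2)
  | uptoZero => rintro _ ⟨j, hj, rfl⟩; exact Nat.zero_le _
  | uptoFinal v =>
    rintro _ ⟨y, ⟨h1, h2⟩, rfl⟩
    exact (tapeOf_eq_bit.1 h2).1
  | outFinal v =>
    rintro _ ⟨y, ⟨h1, h2⟩, rfl⟩
    exact mem_stringSet.2 (Or.inl ⟨v, tapeOf_eq_bit.1 h2, rfl⟩)
  | outLen v =>
    rintro _ ⟨y, ⟨h1, h2⟩, rfl⟩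
    exact mem_stringSet.2 (Or.inr ⟨v, h2, rfl⟩)

theorem AcceptsAt.subset_image (h : AcceptsAt M p T σ) {a b : Node M p} (e : Node.Edge a b)
    (hb : b.IsInter) : computation M p T σ b ⊆ e.arrow.apply (computation M p T σ a) := by
  cases e with
  | readSym b q => exact fun y hy => ⟨y, ⟨hy.1.le, hy.2.1⟩, rfl⟩
  | readHead b q => exact fun y hy => ⟨y, ⟨hy.1.le, hy.2.2⟩, rfl⟩
  | awayNe => exact fun y hy => hy.1
  | awayLive => exact fun y hy => hy.2
  | keepSym a => exact fun y hy => ⟨y, ⟨hy.1.le, hy.2.1⟩, rfl⟩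
  | keepIdle a => exact fun y hy => ⟨y, ⟨hy.1, hy.2.2⟩, rfl⟩
  | finalSym a =>
    refine fun y hy => ⟨y, ⟨hy.1.le, ?_⟩, rfl⟩
    rw [hy.1, h.tape_eq, hy.2]
  | finalTime a => exact fun y hy => hy.1
  | lenFinal => exact fun y hy => ⟨y, ⟨hy.1, tapeOf_eq_blank.2 hy.2.ge⟩, rfl⟩
  | lenUpto => exact fun y hy => hy.2.le
  | _ => exact hb.elim

theorem AcceptsAt.mem_of_forall_mem (h : AcceptsAt M p T σ) {b : Node M p} (hb : b.IsInter)
    (y : b.Carrier)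
    (hy : ∀ (a : Node M p) (e : Node.Edge a b), y ∈ e.arrow.apply (computation M p T σ a)) :
    y ∈ computation M p T σ b := by
  cases b with
  | read b q =>
    obtain ⟨_, ⟨h1, h2⟩, rfl⟩ := hy _ (.readSym b q)
    obtain ⟨y, ⟨h3, h4, h5⟩, rfl⟩ := hy _ (.readHead b q)
    -- The strict bound is not part of either incoming set; it follows because the state at time `T`
    -- is not live.
    exact ⟨h.lt_of_live h1 q h4, h2, h4, h5⟩
  | away => exact ⟨hy _ .awayNe, hy _ .awayLive⟩
  | keep a =>
    obtain ⟨_, ⟨h1, h2⟩, rfl⟩ := hy _ (.keepSym a)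
    obtain ⟨y, ⟨h3, h4⟩, rfl⟩ := hy _ (.keepIdle a)
    exact ⟨h3, h2, h4⟩
  | final a =>
    obtain ⟨y, ⟨h1, h2⟩, rfl⟩ := hy _ (.finalSym a)
    have h3 : y 0 = T := hy _ (.finalTime a)
    refine ⟨h3, ?_⟩
    rw [← h2, h3, h.tape_eq]
  | len =>
    obtain ⟨y, ⟨h1, h2⟩, rfl⟩ := hy _ .lenFinal
    -- A blank cell lies at or beyond the end of the output, and `upto` gives the opposite
    -- inequality.
    exact ⟨h1, le_antisymm (hy _ .lenUpto) (tapeOf_eq_blank.1 h2)⟩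
  | _ => exact hb.elim

/-- At unions every element of the run has a cause: the input at time 0, and otherwise the previous
configuration, which is live because its time is below `T`. -/
theorem AcceptsAt.exists_mem (h : AcceptsAt M p T σ) {b : Node M p} (hb : ¬ b.IsInter)
    (h1 : b ≠ .one) (y : b.Carrier) (hy : y ∈ computation M p T σ b) :
    ∃ (a : Node M p) (e : Node.Edge a b), y ∈ e.arrow.apply (computation M p T σ a) := by
  cases b with
  | read | away | keep | final | len => exact absurd trivial hb
  | one => exact absurd rfl h1
  | empty => exact hy.elim
  | nat => exact ⟨_, .natOne, trivial⟩
  | ne =>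
    change Fin 2 → ℕ at y
    have hy : y 0 ≠ y 1 := hy
    rcases h0 : y 0 with _ | i
    · refine ⟨_, .neLeft, mem_image_pair.2 ⟨y 1 - 1, trivial, h0.symm, ?_⟩⟩
      omega
    · rcases h1 : y 1 with _ | j
      · exact ⟨_, .neRight, mem_image_pair.2 ⟨i, trivial, h0.symm, h1.symm⟩⟩
      · refine ⟨_, .neSelf, mem_image_pair.2 ⟨![i, j], ?_, h0.symm, h1.symm⟩⟩
        change i ≠ j
        omega
  | pos i =>
    induction i using Fin.cases with
    | zero => exact ⟨_, .posZero, (0 : Fin 1), trivial, hy.symm⟩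
    | succ i => exact ⟨_, .posSucc i, (i : ℕ), rfl, (hy : y = (i : ℕ) + 1).symm⟩
  | tail =>
    change ℕ at y
    have hy : p.length ≤ y := hy
    rcases hy.eq_or_lt with hy | hy
    · exact ⟨_, .tailPos, y, hy.symm, rfl⟩
    · refine ⟨_, .tailSelf, y - 1, Nat.le_sub_one_of_lt hy, ?_⟩
      exact Nat.sub_add_cancel (by omega)
  | sym a =>
    change Fin 2 → ℕ at y
    obtain ⟨hT, hy⟩ := hy
    rcases h0 : y 0 with _ | t
    · rw [h0] at hy
      have hy : M.tapeOf p (y 1) = a := hy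
      by_cases hl : y 1 < p.length
      · have : M.tapeOf p (y 1) = M.bit (p.get ⟨y 1, hl⟩) := tapeOf_eq_bit.2 ⟨hl, rfl⟩
        obtain rfl := this.symm.trans hy
        exact ⟨_, .symInput ⟨y 1, hl⟩, mem_image_pair.2 ⟨y 1, rfl, h0.symm, rfl⟩⟩
      · have hl := not_lt.1 hl
        obtain rfl := (tapeOf_eq_blank.2 hl).symm.trans hy
        exact ⟨_, .symBlank, mem_image_pair.2 ⟨y 1, hl, h0.symm, rfl⟩⟩
    · rw [h0] at hy hT
      obtain ⟨q, hq⟩ := h.exists_live hT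
      have hc := (h.config_succ hT rfl hq rfl).2.2
      rw [hc] at hy
      -- A cell at time `t + 1` was either written by the head at time `t` or kept because the head
      -- was elsewhere.
      by_cases hh : (config M p t).head = y 1
      · rw [hh, Function.update_self] at hy
        subst hy
        exact ⟨_, .symWrite _ q, mem_image_pair.2 ⟨![t, y 1], ⟨hT, rfl, hq, hh⟩, h0.symm, rfl⟩⟩
      · rw [Function.update_of_ne (Ne.symm hh)] at hy
        exact ⟨_, .symKeep a, mem_image_pair.2 ⟨![t, y 1], ⟨hT, hy, hh⟩, h0.symm, rfl⟩⟩
  | head q' =>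
    change Fin 2 → ℕ at y
    obtain ⟨hT, hs, hy⟩ := hy
    rcases h0 : y 0 with _ | t
    · rw [h0] at hs hy
      obtain rfl : M.q₀ = q' := hs
      exact ⟨_, .headInit, mem_image_pair.2 ⟨(0 : Fin 1), trivial, h0.symm, hy⟩⟩
    · rw [h0] at hs hy hT
      obtain ⟨q, hq⟩ := h.exists_live hT
      -- Position 0 and successor positions of the head use different maps, in place of a
      -- predecessor function.
      rcases hi : (config M p t).head with _ | i
      · obtain ⟨e1, e2, -⟩ := h.config_succ hT rfl hq hi
        obtain rfl := e1.symm.trans hs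
        exact ⟨_, .headZero _ q, mem_image_pair.2 ⟨t, ⟨hT, rfl, hq, hi⟩, h0.symm, e2.symm.trans hy⟩⟩
      · obtain ⟨e1, e2, -⟩ := h.config_succ hT rfl hq hi
        obtain rfl := e1.symm.trans hs
        exact ⟨_, .headRight _ q, mem_image_pair.2
          ⟨![t, i], ⟨hT, rfl, hq, hi⟩, h0.symm, e2.symm.trans hy⟩⟩
  | readRight b q => exact ⟨_, .rightRead b q, hy⟩
  | readZero b q => exact ⟨_, .zeroRead b q, hy⟩
  | live =>
    obtain ⟨hT, hy⟩ := hy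
    obtain ⟨q, hq⟩ := h.exists_live hT
    exact ⟨_, .liveHead q, y, ⟨hT.le, hq, hy⟩, rfl⟩
  | idle =>
    change Fin 2 → ℕ at y
    obtain ⟨hT, hy⟩ := hy
    exact ⟨_, .idleAway, mem_image_pair.2
      ⟨![y 0, y 1, (config M p (y 0)).head], ⟨Ne.symm hy, hT, rfl⟩, rfl, rfl⟩⟩
  | time =>
    obtain rfl : y = T := hy
    exact ⟨_, .timeHead, ![y, (config M p y).head], ⟨le_rfl, h.accept, rfl⟩, rfl⟩
  | upto =>
    change ℕ at y
    rcases y with _ | i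
    · exact ⟨_, .uptoZero, (0 : Fin 1), trivial, rfl⟩
    · exact ⟨_, .uptoFinal (σ.get ⟨i, hy⟩), ![T, i], ⟨rfl, tapeOf_eq_bit.2 ⟨hy, rfl⟩⟩, rfl⟩
  | out =>
    change Fin 2 → ℕ at y
    rcases mem_stringSet.1 hy with ⟨v, h1, h2⟩ | ⟨v, h1, h2⟩
    · exact ⟨_, .outFinal v, mem_image_pair.2 ⟨![T, y 0], ⟨rfl, tapeOf_eq_bit.2 h1⟩, rfl, h2⟩⟩
    · exact ⟨_, .outLen v, mem_image_pair.2 ⟨![T, y 0], ⟨rfl, h1⟩, rfl, h2⟩⟩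

theorem AcceptsAt.isCrossSection (h : AcceptsAt M p T σ) :
    (diagram M p).IsCrossSection (computation M p T σ) := by
  refine Diagram.isCrossSection_of_edges (fun a b e hb => h.image_subset e hb) ?_
    (fun a b e hb => h.subset_image e (not_not.1 hb))
    (fun b hb y hy => h.mem_of_forall_mem (not_not.1 hb) y hy)
  rintro b hb y hy ⟨a, e⟩
  refine h.exists_mem hb ?_ y hy
  -- The member `one` has no incoming maps, so it is excluded by the map at hand.
  rintro rfl
  cases e

theorem AcceptsAt.represents (h : AcceptsAt M p T σ) :
    (diagram M p).Represents {Node.one} (fun _ => Set.univ) Node.out (stringSet σ) := by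
  refine ⟨⟨computation M p T σ, h.isCrossSection, ?_⟩, ?_⟩
  · rintro ⟨_, rfl⟩
    rfl
  · rintro s ⟨hs, h1⟩
    refine Diagram.IsCrossSection.eq_of_rank (D := diagram M p) Node.rank
      (fun a b e => ⟨e.arrow, rfl, e.arrow_lowers⟩) hs h.isCrossSection ?_ Node.out
    intro b hb
    obtain rfl : b = Node.one := by
      by_contra hne
      exact hb (nonempty_in hne)
    exact h1 ⟨Node.one, rfl⟩

end

/-! ### The bound, and a machine showing that the minimum exists. -/

theorem structuralInfo_le {σ : List (Fin 2)} (h : M.Outputs p σ) :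
    structuralInfo natMaps (stringSet σ) ≤
      (800 * (p.length + M.numSymbols * M.numStates) : ℕ) := by
  obtain ⟨T, hT⟩ := h.exists_acceptsAt
  refine le_trans (sInf_le ?_) (size_diagram_le (M := M) (p := p))
  exact ⟨diagram M p, Node.one, Node.out, rfl, rfl, generatedBy_diagram, hT.represents, rfl⟩

/-- A machine that accepts immediately. -/
def trivialMachine : TuringMachine where
  Q := Unit
  Θ := Option (Fin 2)
  bit := ⟨some, Option.some_injective _⟩
  blank := none
  bit_ne_blank _ := Option.some_ne_none _
  δ x := (x.1, x.2, 0)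
  q₀ := ()
  qA := ()
  qR := ()

theorem trivialMachine_outputs (σ : List (Fin 2)) : trivialMachine.Outputs σ σ :=
  ⟨0, rfl, rfl⟩

end TuringMachine

end StructInfo

/-- There is a constant `c` such that for every binary string `σ` the structural information of
`stringSet σ` relative to `{0, succ}` is at most `c` times the minimum of `|p| + |Θ_M| |Q_M|` over
all Turing machines `M` and inputs `p` with `M(p) = σ`. -/
theorem mainTheorem4 :
    ∃ c : ℕ, ∀ σ : List (Fin 2), ∃ m : ℕ,
      IsLeast {n : ℕ | ∃ (M : StructInfo.TuringMachine) (p : List (Fin 2)),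
        M.Outputs p σ ∧ n = p.length + M.numSymbols * M.numStates} m ∧
      StructInfo.structuralInfo StructInfo.natMaps (StructInfo.stringSet σ) ≤
        (c : ℕ∞) * (m : ℕ∞) := by
  refine ⟨800, fun σ => ?_⟩
  -- The minimum is over a nonempty set, since the machine that halts at once outputs its input `σ`.
  have hne : {n : ℕ | ∃ (M : StructInfo.TuringMachine) (p : List (Fin 2)),
      M.Outputs p σ ∧ n = p.length + M.numSymbols * M.numStates}.Nonempty :=
    ⟨_, StructInfo.TuringMachine.trivialMachine, σ,
      StructInfo.TuringMachine.trivialMachine_outputs σ, rfl⟩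
  refine ⟨_, ⟨Nat.sInf_mem hne, fun n hn => Nat.sInf_le hn⟩, ?_⟩
  obtain ⟨M, p, h, hm⟩ := Nat.sInf_mem hne
  rw [hm]
  exact_mod_cast StructInfo.TuringMachine.structuralInfo_le h
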